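/- Let $A\in\mathbb{R}^{m\times n}$, $b\in\mathbb{R}^m$ and $C=(c_{ij})\in\mathbb{R}^{k\times n}$. For vectors, $u\leqq v$ denotes the componentwise order. Let $\mathcal{X}=\{x\in\mathbb{Z}^n : x\geqq 0,\ Ax\leqq b\}$ and consider the multiobjective integer program (MOIP) of maximizing $Cx$ over $x\in\mathcal{X}$. Its nondominated points are the $z\in\mathcal{Y}=\{Cx: x\in\mathcal{X}\}$ for which there is no $y\in\mathcal{Y}$ with $z\leqq y$, $y\neq z$. Its ideal point, if it exists, is the $y^I\in\mathbb{R}^k$ such that for every $i$ the maximum of $(Cx)_i$ over $x\in\mathcal{X}$ is attained and equals $y^I_i$. The vector-valued superadditive dual (VSDP) is the problem of minimizing $F(b)=(f_1(b),\dots,f_k(b))^\top$ over all $F=(f_1,\dots,f_k)$ such that each $f_i:\mathbb{R}^m\to\mathbb{R}$ is nondecreasing with respect to $\leqq$ and superadditive ($f_i(\beta_1)+f_i(\beta_2)\le f_i(\beta_1+\beta_2)$ for all $\beta_1,\beta_2$), $f_i(0)=0$, and $f_i(A_j)\ge c_{ij}$ for every column $A_j$ of $A$. Its nondominated points are the values $F(b)$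 of feasible $F$ for which there is no feasible $G$ with $G(b)\leqq F(b)$, $G(b)\ne F(b)$. A feasible $F$ is efficient if $F(b)$ is nondominated. The VSDP is called strong if it has an efficient solution $F^*$ such that $F^*(b)$ is a nondominated point of the MOIP. Theorem. (a) If the VSDP is strong, then the MOIP has a unique nondominated point $z$, the point $z$ is also the unique nondominated point of the VSDP, and $z$ is the ideal point of the MOIP. Moreover, the VSDP always has at most one nondominated point. (b) Suppose that all entries of $A$ are rational. Then the VSDP is strong if and only if the MOIP has a unique nondominated point; in that case, the unique nondominated point of the VSDP equals the unique nondominated point of the MOIP. In general, a point $p\in\mathbb{R}^k$ is a nondominated point of the VSDP if and only if it is the ideal point of the MOIP; so the VSDP has a nondominated point exactly when the ideal point exists, and the two then coincide. -/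

import Mathlib

open Matrix

/-- The points of `S` that are nondominated from above: no `t ∈ S` has `s ≤ t` (componentwise)
and `s ≠ t`. -/
def nondominatedAbove {k : ℕ} (S : Set (Fin k → ℝ)) : Set (Fin k → ℝ) :=
  {s | s ∈ S ∧ ¬ ∃ t ∈ S, s ≤ t ∧ s ≠ t}

/-- The points of `S` that are nondominated from below. -/
def nondominatedBelow {k : ℕ} (S : Set (Fin k → ℝ)) : Set (Fin k → ℝ) :=
  {s | s ∈ S ∧ ¬ ∃ t ∈ S, t ≤ s ∧ t ≠ s}

/-- The feasible region `{x ∈ ℤⁿ : x ≥ 0, A x ≤ b}` of the integer program. -/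
def moipFeasible {m n : ℕ} (A : Matrix (Fin m) (Fin n) ℝ) (b : Fin m → ℝ) :
    Set (Fin n → ℤ) :=
  {x | 0 ≤ x ∧ A *ᵥ (fun j => (x j : ℝ)) ≤ b}

/-- The set `{C x : x feasible}` of feasible objective values of the integer program. -/
def moipValues {m n k : ℕ} (A : Matrix (Fin m) (Fin n) ℝ) (b : Fin m → ℝ)
    (C : Matrix (Fin k) (Fin n) ℝ) : Set (Fin k → ℝ) :=
  {y | ∃ x ∈ moipFeasible A b, y = C *ᵥ (fun j => (x j : ℝ))}

/-- The nondominated points of the MOIP `max C x` s.t. `A x ≤ b`, `x ∈ ℤⁿ`, `x ≥ 0`. -/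
def moipNondominated {m n k : ℕ} (A : Matrix (Fin m) (Fin n) ℝ) (b : Fin m → ℝ)
    (C : Matrix (Fin k) (Fin n) ℝ) : Set (Fin k → ℝ) :=
  nondominatedAbove (moipValues A b C)

/-- `y` is the ideal point of the MOIP: `y i` is the (attained) maximum of the `i`-th objective
over the feasible region. -/
def IsIdealPoint {m n k : ℕ} (A : Matrix (Fin m) (Fin n) ℝ) (b : Fin m → ℝ)
    (C : Matrix (Fin k) (Fin n) ℝ) (y : Fin k → ℝ) : Prop :=
  ∀ i, IsGreatest {r : ℝ | ∃ x ∈ moipFeasible A b, r = (C *ᵥ (fun j => (x j : ℝ))) i} (y i)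

/-- Superadditivity of a real function on `ℝᵐ`. -/
def IsSuperadditive {m : ℕ} (f : (Fin m → ℝ) → ℝ) : Prop :=
  ∀ β₁ β₂, f β₁ + f β₂ ≤ f (β₁ + β₂)

/-- Feasibility of `F = (f₁, …, f_k)` for the vector-valued superadditive dual;
`A.col j` is the `j`-th column of `A`. -/
structure VSDPFeasible {m n k : ℕ} (A : Matrix (Fin m) (Fin n) ℝ)
    (C : Matrix (Fin k) (Fin n) ℝ) (F : Fin k → (Fin m → ℝ) → ℝ) : Prop where
  column_bound : ∀ i j, C i j ≤ F i (A.col j)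
  map_zero : ∀ i, F i 0 = 0
  monotone : ∀ i, Monotone (F i)
  superadditive : ∀ i, IsSuperadditive (F i)

/-- The set of feasible objective values `F(b)` of the vector-valued superadditive dual. -/
def vsdpValues {m n k : ℕ} (A : Matrix (Fin m) (Fin n) ℝ) (b : Fin m → ℝ)
    (C : Matrix (Fin k) (Fin n) ℝ) : Set (Fin k → ℝ) :=
  {y | ∃ F : Fin k → (Fin m → ℝ) → ℝ, VSDPFeasible A C F ∧ y = fun i => F i b}

/-- The nondominated points of the vector-valued superadditive dual (a minimization problem). -/
def vsdpNondominated {m n k : ℕ} (A : Matrix (Fin m) (Fin n) ℝ) (b : Fin m → ℝ)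
    (C : Matrix (Fin k) (Fin n) ℝ) : Set (Fin k → ℝ) :=
  nondominatedBelow (vsdpValues A b C)

/-- The vector-valued superadditive dual is strong: some efficient dual solution `F` has an
objective value `F(b)` that is a nondominated point of the MOIP. -/
def VSDPStrong {m n k : ℕ} (A : Matrix (Fin m) (Fin n) ℝ) (b : Fin m → ℝ)
    (C : Matrix (Fin k) (Fin n) ℝ) : Prop :=
  ∃ F : Fin k → (Fin m → ℝ) → ℝ, VSDPFeasible A C F ∧
    (fun i => F i b) ∈ vsdpNondominated A b C ∧ (fun i => F i b) ∈ moipNondominated A b C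

/-! The dual constraints on the components of F are independent, so a nondominated dual point is
exactly a vector of scalar dual minima; hence there is at most one. Weak duality makes F(b) an upper
bound of all primal values, so a strong dual value is their greatest element. Neither fact needs
rationality.

For rational A everything reduces to scalar strong duality, `isLeast_dual_iff_isGreatest`. Farkas
over ℚ with real values gives LP multipliers y even when c is real, since the hypothesis is tested
only on rational directions, which scale to integer ones. The plain value function is undefined at
infeasible right-hand sides; paying M per unit of relaxation repairs this and keeps superadditivity.
As relaxation is counted in whole units, a large M makes it useless at b, so every primal upper
bound also bounds some dual value (`exists_isDualFeasible_le`).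

Maxima are attained by Dickson's lemma: an infinite improving sequence would yield an improving
recession direction. The same argument puts every feasible value below a nondominated one, so a
unique nondominated point is greatest. -/

/-! ### Farkas' lemma over an ordered field with values in an ordered vector space -/

/-- **Bartl's form of Farkas' lemma**: a linear map `γ` into a linearly ordered vector space that
is nonpositive wherever finitely many linear forms `α i` are nonpositive is a combination of
these forms with nonnegative vector coefficients. -/
theorem exists_nonneg_sum_smul_eq_of_nonpos {K W V : Type*} [Field K] [LinearOrder K]
    [IsStrictOrderedRing K] [AddCommGroup W] [Module K W] [AddCommGroup V] [LinearOrder V]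
    [IsOrderedAddMonoid V] [Module K V] [PosSMulMono K V] {N : ℕ} (α : Fin N → W →ₗ[K] K)
    (γ : W →ₗ[K] V) (h : ∀ w, (∀ i, α i w ≤ 0) → γ w ≤ 0) :
    ∃ u : Fin N → V, 0 ≤ u ∧ ∀ w, γ w = ∑ i, α i w • u i := by
  induction N generalizing γ with
  | zero =>
    refine ⟨0, le_rfl, fun w => ?_⟩
    have h₁ := h w (fun i => i.elim0)
    have h₂ := h (-w) (fun i => i.elim0)
    rw [map_neg, neg_nonpos] at h₂
    simpa using le_antisymm h₁ h₂
  | succ N ih =>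
    -- If `α 0` is redundant, it gets coefficient 0.
    by_cases hN : ∀ w, (∀ i : Fin N, α i.succ w ≤ 0) → γ w ≤ 0
    · obtain ⟨u, hu, hγ⟩ := ih (fun i => α i.succ) γ hN
      refine ⟨Fin.cons 0 u, fun i => ?_, fun w => ?_⟩
      · refine Fin.cases ?_ (fun i => ?_) i
        · simp
        · simpa using hu i
      · simp [Fin.sum_univ_succ, hγ w]
    · push Not at hN
      obtain ⟨w₀, hw₀, hγ₀⟩ := hN
      have ha : 0 < α 0 w₀ := by
        by_contra! ha
        exact absurd (h w₀ (fun i => Fin.cases ha hw₀ i)) (not_le.2 hγ₀)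
      set w₁ := (α 0 w₀)⁻¹ • w₀ with hw₁
      have ha₁ : α 0 w₁ = 1 := by simp [hw₁, ha.ne']
      have hα₁ : ∀ i : Fin N, α i.succ w₁ ≤ 0 := fun i => by
        rw [hw₁, map_smul, smul_eq_mul]
        exact mul_nonpos_of_nonneg_of_nonpos (inv_nonneg.2 ha.le) (hw₀ i)
      have hγ₁ : 0 ≤ γ w₁ := by
        rw [hw₁, map_smul]
        exact smul_nonneg (inv_nonneg.2 ha.le) hγ₀.le
      -- Projection onto the kernel of `α 0` along `w₁`; there only the other forms constrain `γ`.
      let P : W →ₗ[K] W := LinearMap.id - (α 0).smulRight w₁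
      have hP : ∀ w, P w = w - α 0 w • w₁ := fun w => by simp [P]
      obtain ⟨u, hu, hγ⟩ := ih (fun i => (α i.succ).comp P) (γ.comp P) (fun w hw => by
        refine h _ (fun i => Fin.cases ?_ hw i)
        simp [hP, ha₁])
      -- The coefficient of `α 0` is forced by evaluating the identity at `w₁`.
      refine ⟨Fin.cons (γ w₁ - ∑ i : Fin N, α i.succ w₁ • u i) u, fun i => ?_, fun w => ?_⟩
      · refine Fin.cases ?_ (fun i => ?_) i
        · simp only [Pi.zero_apply, Fin.cons_zero, sub_nonneg]
          refine (Finset.sum_nonpos fun i _ => ?_).trans hγ₁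
          have := smul_nonneg (neg_nonneg.2 (hα₁ i)) (hu i)
          rwa [neg_smul, neg_nonneg] at this
        · simpa using hu i
      · have := hγ w
        simp only [LinearMap.comp_apply, hP, map_sub, map_smul, sub_smul, smul_eq_mul,
          Finset.sum_sub_distrib] at this
        rw [Fin.sum_univ_succ]
        simp only [Fin.cons_zero, Fin.cons_succ, smul_sub, Finset.smul_sum, smul_smul]
        rw [sub_eq_iff_eq_add.1 this]
        abel

/-- A family of rational numbers has a common denominator. -/
theorem exists_pos_int_mul_eq {ι : Type*} [Finite ι] (f : ι → ℚ) :
    ∃ N : ℤ, 0 < N ∧ ∀ i, ∃ z : ℤ, (N : ℚ) * f i = z := by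
  obtain ⟨N, hN⟩ := IsLocalization.exist_integer_multiples_of_finite (nonZeroDivisors ℤ) f
  refine ⟨|(N : ℤ)|, abs_pos.2 (nonZeroDivisors.coe_ne_zero N), fun i => ?_⟩
  obtain ⟨z, hz⟩ := hN i
  simp only [algebraMap_int_eq, eq_intCast, zsmul_eq_mul] at hz
  rcases abs_choice (N : ℤ) with h | h <;> rw [h]
  · exact ⟨z, hz.symm⟩
  · exact ⟨-z, by push_cast; rw [neg_mul, ← hz]⟩

/-! ### Rational constraint matrices -/

/-- If `c` is nonpositive on the integer recession directions of `{x ≥ 0 : A x ≤ b}`, where `A`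
is rational, then the dual linear program is feasible. -/
theorem exists_dual_multipliers {m n : ℕ} {A : Matrix (Fin m) (Fin n) ℝ}
    (hA : ∀ i j, ∃ q : ℚ, A i j = (q : ℝ)) {c : Fin n → ℝ}
    (hc : ∀ d ∈ moipFeasible A 0, c ⬝ᵥ (fun j => (d j : ℝ)) ≤ 0) :
    ∃ y : Fin m → ℝ, 0 ≤ y ∧ c ≤ y ᵥ* A := by
  choose Q hQ using hA
  -- The forms are the rows of A and the negated coordinates. The multipliers of the latter become
  -- the slack in `c ≤ y ᵥ* A`.
  let α : Fin (m + n) → (Fin n → ℚ) →ₗ[ℚ] ℚ :=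
    Fin.append (fun i => ∑ j, Q i j • LinearMap.proj j) (fun j => -LinearMap.proj j)
  let γ : (Fin n → ℚ) →ₗ[ℚ] ℝ := ∑ j, (LinearMap.proj j).smulRight (c j)
  have hγ : ∀ w, γ w = c ⬝ᵥ (fun j => (w j : ℝ)) := fun w => by
    simp [γ, dotProduct, Rat.smul_def, mul_comm]
  obtain ⟨u, hu, hsum⟩ := exists_nonneg_sum_smul_eq_of_nonpos α γ (fun w hw => by
    obtain ⟨N, hN, hz⟩ := exists_pos_int_mul_eq w
    choose z hz using hz
    have hzR : ∀ j, (z j : ℝ) = N * (w j : ℝ) := fun j => by exact_mod_cast (hz j).symm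
    have hNR : (0 : ℝ) < N := by exact_mod_cast hN
    have hzw : (fun j => (z j : ℝ)) = (N : ℝ) • fun j => (w j : ℝ) := funext hzR
    have hmem : z ∈ moipFeasible A 0 := by
      refine ⟨fun j => ?_, fun i => ?_⟩
      · have h₁ := hw (Fin.natAdd m j)
        simp only [α, Fin.append_right, LinearMap.neg_apply, LinearMap.proj_apply,
          neg_nonpos] at h₁
        have h₂ : (0 : ℝ) ≤ z j := by
          rw [hzR]
          exact mul_nonneg hNR.le (by exact_mod_cast h₁)
        exact_mod_cast h₂
      · have h₁ := hw (Fin.castAdd n i)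
        simp only [α, Fin.append_left, LinearMap.sum_apply, LinearMap.smul_apply,
          LinearMap.proj_apply, smul_eq_mul] at h₁
        rw [hzw, mulVec_smul]
        refine mul_nonpos_of_nonneg_of_nonpos hNR.le ?_
        simp only [mulVec, dotProduct, hQ]
        exact_mod_cast h₁
    have h := hc z hmem
    rw [hzw, dotProduct_smul, smul_eq_mul] at h
    rw [hγ]
    exact nonpos_of_mul_nonpos_right h hNR)
  refine ⟨fun i => u (Fin.castAdd n i), fun i => hu _, fun j => ?_⟩
  have h := hsum (Pi.single j 1)
  have h₁ : γ (Pi.single j 1) = c j := by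
    rw [hγ, dotProduct, Finset.sum_eq_single j] <;> simp +contextual
  rw [h₁, Fin.sum_univ_add] at h
  have h₂ : ∀ i, α (Fin.castAdd n i) (Pi.single j 1) = Q i j := fun i => by
    simp [α, Pi.single_apply]
  have h₃ : ∀ l, α (Fin.natAdd m l) (Pi.single j 1) = if l = j then -1 else 0 := fun l => by
    by_cases hl : l = j <;> simp [α, hl]
  simp only [h₂, h₃, ite_smul, zero_smul, Finset.sum_ite_eq', Finset.mem_univ, if_true,
    neg_smul, one_smul] at h
  have h₄ : ((fun i => u (Fin.castAdd n i)) ᵥ* A) j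
      = ∑ i, Q i j • u (Fin.castAdd n i) := by
    simp [vecMul, dotProduct, hQ, Rat.smul_def, mul_comm]
  have h₅ := hu (Fin.natAdd m j)
  simp only [Pi.zero_apply] at h₅
  linarith

/-! ### Recession directions and attainment -/

/-- In a sequence of feasible points of a rational integer program, some later point arises from
an earlier one by adding an integer recession direction. -/
theorem exists_lt_sub_mem_moipFeasible_zero {m n : ℕ} {A : Matrix (Fin m) (Fin n) ℝ}
    (hA : ∀ i j, ∃ q : ℚ, A i j = (q : ℝ)) {b : Fin m → ℝ} (x : ℕ → Fin n → ℤ)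
    (hx : ∀ s, x s ∈ moipFeasible A b) :
    ∃ s t, s < t ∧ x t - x s ∈ moipFeasible A 0 := by
  choose Q hQ using hA
  obtain ⟨N, hN, hB⟩ := exists_pos_int_mul_eq (fun p : Fin m × Fin n => Q p.1 p.2)
  choose B hB using hB
  have hNR : (0 : ℝ) < N := by exact_mod_cast hN
  have hBR : ∀ i j, (B (i, j) : ℝ) = N * A i j := fun i j => by
    rw [hQ]
    exact_mod_cast (hB (i, j)).symm
  have hmul : ∀ (w : Fin n → ℤ) i, ((∑ j, B (i, j) * w j : ℤ) : ℝ)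
      = N * (A *ᵥ fun j => (w j : ℝ)) i := fun w i => by
    push_cast
    simp only [hBR, mulVec, dotProduct, Finset.mul_sum, mul_assoc]
  -- Clearing denominators allows the right-hand side to be rounded down, so the slacks are natural
  -- numbers.
  let slack : ℕ → Fin m → ℤ := fun s i => ⌊(N : ℝ) * b i⌋ - ∑ j, B (i, j) * x s j
  have hslack : ∀ s i, 0 ≤ slack s i := fun s i => by
    refine sub_nonneg.2 (Int.le_floor.2 ?_)
    rw [hmul]
    exact mul_le_mul_of_nonneg_left ((hx s).2 i) hNR.le
  -- Dickson's lemma: coordinates and slacks both weakly increase from s to t, and growing slack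
  -- means A(x t - x s) ≤ 0.
  obtain ⟨s, t, hst, hle⟩ := wellQuasiOrdered_le
    (fun s => ((fun j => (x s j).toNat, fun i => (slack s i).toNat) :
      (Fin n → ℕ) × (Fin m → ℕ)))
  refine ⟨s, t, hst, fun j => ?_, fun i => ?_⟩
  · have h₁ := hle.1 j
    have h₂ := (hx s).1 j
    have h₃ := (hx t).1 j
    simp only [Pi.zero_apply, Pi.sub_apply] at *
    omega
  · have h₁ := hle.2 i
    have h₂ := hslack s i
    have h₃ := hslack t i
    have h₄ : ∑ j, B (i, j) * (x t - x s) j ≤ 0 := by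
      simp only [Pi.sub_apply, mul_sub, Finset.sum_sub_distrib]
      simp only [slack] at h₁ h₂ h₃
      omega
    have h₅ : (N : ℝ) * (A *ᵥ fun j => ((x t - x s) j : ℝ)) i ≤ 0 := by
      rw [← hmul]
      exact_mod_cast h₄
    exact nonpos_of_mul_nonpos_right h₅ hNR

theorem mulVec_intCast_add {m n : ℕ} (A : Matrix (Fin m) (Fin n) ℝ) (x d : Fin n → ℤ) :
    A *ᵥ (fun j => ((x + d) j : ℝ))
      = A *ᵥ (fun j => (x j : ℝ)) + A *ᵥ (fun j => (d j : ℝ)) := by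
  rw [← mulVec_add]
  congr 1
  ext j
  simp

theorem add_mem_moipFeasible {m n : ℕ} {A : Matrix (Fin m) (Fin n) ℝ} {b b' : Fin m → ℝ}
    {x d : Fin n → ℤ} (hx : x ∈ moipFeasible A b) (hd : d ∈ moipFeasible A b') :
    x + d ∈ moipFeasible A (b + b') :=
  ⟨add_nonneg hx.1 hd.1, (mulVec_intCast_add A x d).trans_le (add_le_add hx.2 hd.2)⟩

theorem add_recession_mem_moipFeasible {m n : ℕ} {A : Matrix (Fin m) (Fin n) ℝ} {b : Fin m → ℝ}
    {x d : Fin n → ℤ} (hx : x ∈ moipFeasible A b) (hd : d ∈ moipFeasible A 0) :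
    x + d ∈ moipFeasible A b :=
  add_zero b ▸ add_mem_moipFeasible hx hd

/-- If no integer recession direction improves the objectives, then every feasible value is
dominated by a nondominated one. -/
theorem exists_moipNondominated_ge {m n k : ℕ} {A : Matrix (Fin m) (Fin n) ℝ}
    (hA : ∀ i j, ∃ q : ℚ, A i j = (q : ℝ)) {b : Fin m → ℝ} {C : Matrix (Fin k) (Fin n) ℝ}
    (hC : ∀ d ∈ moipFeasible A 0, ¬ 0 < C *ᵥ (fun j => (d j : ℝ)))
    {x : Fin n → ℤ} (hx : x ∈ moipFeasible A b) :
    ∃ z ∈ moipNondominated A b C, C *ᵥ (fun j => (x j : ℝ)) ≤ z := by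
  let val : (Fin n → ℤ) → Fin k → ℝ := fun w => C *ᵥ (fun j => (w j : ℝ))
  have hwf : WellFounded (fun v w : moipFeasible A b => val w < val v) := by
    rw [RelEmbedding.wellFounded_iff_isEmpty]
    refine ⟨fun f => ?_⟩
    obtain ⟨s, t, hst, hd⟩ := exists_lt_sub_mem_moipFeasible_zero hA
      (fun s => (f s : Fin n → ℤ)) (fun s => (f s).2)
    have h₁ : val (f s) < val (f t) := f.map_rel_iff.2 hst
    refine hC _ hd ?_
    have h₂ := mulVec_intCast_add C (f s) (f t - f s)
    rw [add_sub_cancel] at h₂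
    exact pos_of_lt_add_right (h₁.trans_eq h₂)
  obtain ⟨w, hw, hmax⟩ := hwf.has_min {w | val x ≤ val w} ⟨⟨x, hx⟩, le_refl (val x)⟩
  refine ⟨val w, ⟨⟨w, w.2, rfl⟩, ?_⟩, hw⟩
  rintro ⟨_, ⟨v, hv, rfl⟩, hle, hne⟩
  exact hmax ⟨v, hv⟩ (le_trans hw hle) (lt_of_le_of_ne hle hne)

/-- A linear objective that is nonpositive on the integer recession directions attains its
maximum over a nonempty rational integer program. -/
theorem exists_isGreatest_dotProduct {m n : ℕ} {A : Matrix (Fin m) (Fin n) ℝ}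
    (hA : ∀ i j, ∃ q : ℚ, A i j = (q : ℝ)) {b : Fin m → ℝ} {c : Fin n → ℝ}
    (hc : ∀ d ∈ moipFeasible A 0, c ⬝ᵥ (fun j => (d j : ℝ)) ≤ 0)
    (hne : (moipFeasible A b).Nonempty) :
    ∃ r, IsGreatest {r : ℝ | ∃ x ∈ moipFeasible A b, r = c ⬝ᵥ (fun j => (x j : ℝ))} r := by
  obtain ⟨x, hx⟩ := hne
  obtain ⟨_, ⟨⟨v, hv, rfl⟩, hmax⟩, -⟩ := exists_moipNondominated_ge (k := 1) (C := fun _ => c) hA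
    (fun d hd h => ((Pi.lt_def.1 h).2.elim fun _ hi => hi.not_ge (hc d hd))) hx
  refine ⟨_, ⟨v, hv, rfl⟩, ?_⟩
  rintro _ ⟨w, hw, rfl⟩
  by_contra! hlt
  exact hmax ⟨_, ⟨w, hw, rfl⟩, fun _ => hlt.le, fun h => hlt.ne (congrFun h 0)⟩

/-! ### The scalar superadditive dual -/

/-- Feasibility of `f` for the superadditive dual of `max c x` s.t. `A x ≤ b`. -/
structure IsDualFeasible {m n : ℕ} (A : Matrix (Fin m) (Fin n) ℝ) (c : Fin n → ℝ)
    (f : (Fin m → ℝ) → ℝ) : Prop where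
  column_bound : ∀ j, c j ≤ f (A.col j)
  map_zero : f 0 = 0
  monotone : Monotone f
  superadditive : IsSuperadditive f

theorem vsdpFeasible_iff {m n k : ℕ} {A : Matrix (Fin m) (Fin n) ℝ}
    {C : Matrix (Fin k) (Fin n) ℝ} {F : Fin k → (Fin m → ℝ) → ℝ} :
    VSDPFeasible A C F ↔ ∀ i, IsDualFeasible A (C i) (F i) :=
  ⟨fun h i => ⟨h.1 i, h.2 i, h.3 i, h.4 i⟩,
    fun h => ⟨fun i => (h i).1, fun i => (h i).2, fun i => (h i).3, fun i => (h i).4⟩⟩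

namespace IsDualFeasible

variable {m n : ℕ} {A : Matrix (Fin m) (Fin n) ℝ} {c : Fin n → ℝ} {f : (Fin m → ℝ) → ℝ}

theorem nsmul_le (hf : IsDualFeasible A c f) (s : ℕ) (v : Fin m → ℝ) : s • f v ≤ f (s • v) := by
  induction s with
  | zero => simp [hf.map_zero]
  | succ s ih =>
    rw [succ_nsmul, succ_nsmul]
    exact (add_le_add_left ih _).trans (hf.superadditive _ _)

theorem sum_le (hf : IsDualFeasible A c f) {ι : Type*} (s : Finset ι) (v : ι → Fin m → ℝ) :
    ∑ j ∈ s, f (v j) ≤ f (∑ j ∈ s, v j) := by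
  classical
  induction s using Finset.induction_on with
  | empty => simp [hf.map_zero]
  | insert a s ha ih =>
    rw [Finset.sum_insert ha, Finset.sum_insert ha]
    exact (add_le_add_right ih _).trans (hf.superadditive _ _)

/-- Weak duality. -/
theorem dotProduct_le (hf : IsDualFeasible A c f) {b : Fin m → ℝ} {x : Fin n → ℤ}
    (hx : x ∈ moipFeasible A b) : c ⬝ᵥ (fun j => (x j : ℝ)) ≤ f b := by
  lift x to Fin n → ℕ using hx.1
  have hAx : ∑ j, x j • A.col j = A *ᵥ (fun j => ((x j : ℤ) : ℝ)) := by
    ext i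
    simp [mulVec, dotProduct, mul_comm]
  calc c ⬝ᵥ (fun j => ((x j : ℤ) : ℝ)) = ∑ j, x j • c j := by simp [dotProduct, mul_comm]
    _ ≤ ∑ j, f (x j • A.col j) := Finset.sum_le_sum fun j _ =>
        (nsmul_le_nsmul_right (hf.column_bound j) _).trans (hf.nsmul_le _ _)
    _ ≤ f (∑ j, x j • A.col j) := hf.sum_le _ _
    _ ≤ f b := hf.monotone (hAx.trans_le hx.2)

/-- Weak duality at right-hand side 0. -/
theorem dotProduct_recession_nonpos (hf : IsDualFeasible A c f) :
    ∀ d ∈ moipFeasible A 0, c ⬝ᵥ (fun j => (d j : ℝ)) ≤ 0 :=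
  fun _ hd => (hf.dotProduct_le hd).trans_eq hf.map_zero

end IsDualFeasible

/-! ### The penalized value function -/

/-- The values of the relaxation of `max c x` s.t. `A x ≤ β` in which the right-hand side may be
raised by any natural number `t` at the price `M t`. -/
def penalizedValues {m n : ℕ} (A : Matrix (Fin m) (Fin n) ℝ) (c : Fin n → ℝ) (M : ℝ)
    (β : Fin m → ℝ) : Set ℝ :=
  {r | ∃ (t : ℕ) (x : Fin n → ℤ), x ∈ moipFeasible A (β + fun _ => (t : ℝ)) ∧
    r = c ⬝ᵥ (fun j => (x j : ℝ)) - M * t}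

section Penalized

variable {m n : ℕ} {A : Matrix (Fin m) (Fin n) ℝ} {c : Fin n → ℝ} {y : Fin m → ℝ} {M : ℝ}

/-- Weak linear programming duality. -/
theorem dotProduct_le_of_mem_moipFeasible (hy : 0 ≤ y) (hc : c ≤ y ᵥ* A) {b : Fin m → ℝ}
    {x : Fin n → ℤ} (hx : x ∈ moipFeasible A b) : c ⬝ᵥ (fun j => (x j : ℝ)) ≤ y ⬝ᵥ b := by
  have hx0 : (0 : Fin n → ℝ) ≤ fun j => (x j : ℝ) := fun j => Int.cast_nonneg (hx.1 j)
  calc c ⬝ᵥ (fun j => (x j : ℝ)) ≤ (y ᵥ* A) ⬝ᵥ (fun j => (x j : ℝ)) :=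
        dotProduct_le_dotProduct_of_nonneg_right hc hx0
    _ = y ⬝ᵥ (A *ᵥ fun j => (x j : ℝ)) := (dotProduct_mulVec _ _ _).symm
    _ ≤ y ⬝ᵥ b := dotProduct_le_dotProduct_of_nonneg_left hx.2 hy

/-- The LP bound grows at rate `∑ i, y i` in t, so this sum is the price threshold for boundedness.
-/
theorem le_of_mem_penalized (hy : 0 ≤ y) (hc : c ≤ y ᵥ* A) {β : Fin m → ℝ} {t : ℕ}
    {x : Fin n → ℤ} (hx : x ∈ moipFeasible A (β + fun _ => (t : ℝ))) :
    c ⬝ᵥ (fun j => (x j : ℝ)) ≤ y ⬝ᵥ β + (∑ i, y i) * t := by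
  refine (dotProduct_le_of_mem_moipFeasible hy hc hx).trans_eq ?_
  rw [dotProduct_add]
  simp only [dotProduct, Finset.sum_mul]

theorem le_of_mem_penalizedValues (hy : 0 ≤ y) (hc : c ≤ y ᵥ* A) (hM : ∑ i, y i ≤ M)
    {β : Fin m → ℝ} {r : ℝ} (hr : r ∈ penalizedValues A c M β) : r ≤ y ⬝ᵥ β := by
  obtain ⟨t, x, hx, rfl⟩ := hr
  have h₁ := le_of_mem_penalized hy hc hx
  have h₂ := mul_le_mul_of_nonneg_right hM t.cast_nonneg
  linarith

theorem bddAbove_penalizedValues (hy : 0 ≤ y) (hc : c ≤ y ᵥ* A) (hM : ∑ i, y i ≤ M)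
    (β : Fin m → ℝ) : BddAbove (penalizedValues A c M β) :=
  ⟨_, fun _ => le_of_mem_penalizedValues hy hc hM⟩

theorem penalizedValues_nonempty (A : Matrix (Fin m) (Fin n) ℝ) (c : Fin n → ℝ) (M : ℝ)
    (β : Fin m → ℝ) : (penalizedValues A c M β).Nonempty := by
  -- A t this large makes x = 0 feasible.
  obtain ⟨t, ht⟩ := exists_nat_ge (∑ i, |β i|)
  refine ⟨_, t, 0, ⟨le_rfl, fun i => ?_⟩, rfl⟩
  have h₁ := Finset.single_le_sum (f := fun i => |β i|) (fun i _ => abs_nonneg _)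
    (Finset.mem_univ i)
  have h₂ := neg_abs_le (β i)
  simp only [Pi.zero_apply, Int.cast_zero, mulVec, dotProduct, mul_zero, Finset.sum_const_zero,
    Pi.add_apply]
  linarith

theorem mem_penalizedValues_of_mem_moipFeasible {β : Fin m → ℝ} {x : Fin n → ℤ}
    (hx : x ∈ moipFeasible A β) : c ⬝ᵥ (fun j => (x j : ℝ)) ∈ penalizedValues A c M β :=
  ⟨0, x, by simpa [← Pi.zero_def] using hx, by simp⟩

/-- For a sufficiently large price, the penalized value function is dual feasible. -/
theorem isDualFeasible_sSup_penalizedValues (hy : 0 ≤ y) (hc : c ≤ y ᵥ* A)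
    (hM : ∑ i, y i ≤ M) : IsDualFeasible A c (fun β => sSup (penalizedValues A c M β)) where
  column_bound j := by
    refine le_csSup (bddAbove_penalizedValues hy hc hM _) ?_
    have hcast : (fun l => ((Pi.single j 1 : Fin n → ℤ) l : ℝ)) = Pi.single j 1 := by
      ext l
      by_cases hl : l = j
      · subst hl; simp
      · simp [hl]
    have h := mem_penalizedValues_of_mem_moipFeasible (A := A) (c := c) (M := M) (β := A.col j)
      (x := Pi.single j 1) ⟨Pi.single_nonneg.2 zero_le_one, by
        rw [hcast, mulVec_single_one]⟩
    rwa [hcast, dotProduct_single, mul_one] at h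
  map_zero := by
    refine le_antisymm (csSup_le (penalizedValues_nonempty A c M 0) fun r hr => ?_)
      (le_csSup (bddAbove_penalizedValues hy hc hM _) ?_)
    · exact (le_of_mem_penalizedValues hy hc hM hr).trans_eq (dotProduct_zero y)
    · have hcast : (fun l => ((0 : Fin n → ℤ) l : ℝ)) = 0 := by ext; simp
      have h := mem_penalizedValues_of_mem_moipFeasible (A := A) (c := c) (M := M) (β := 0)
        (x := 0) ⟨le_rfl, by rw [hcast, mulVec_zero]⟩
      rwa [hcast, dotProduct_zero] at h
  monotone β β' hβ := by
    refine csSup_le_csSup (bddAbove_penalizedValues hy hc hM _) (penalizedValues_nonempty _ _ _ _)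
      ?_
    rintro _ ⟨t, x, hx, rfl⟩
    exact ⟨t, x, ⟨hx.1, hx.2.trans (add_le_add_left hβ _)⟩, rfl⟩
  superadditive β₁ β₂ := by
    rw [← le_sub_iff_add_le]
    refine csSup_le (penalizedValues_nonempty _ _ _ _) ?_
    rintro _ ⟨t₁, x₁, hx₁, rfl⟩
    rw [le_sub_comm]
    refine csSup_le (penalizedValues_nonempty _ _ _ _) ?_
    rintro _ ⟨t₂, x₂, hx₂, rfl⟩
    rw [le_sub_iff_add_le]
    refine le_csSup (bddAbove_penalizedValues hy hc hM _) ⟨t₁ + t₂, x₁ + x₂, ?_, ?_⟩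
    · convert add_mem_moipFeasible hx₁ hx₂ using 1
      rw [Nat.cast_add, ← Pi.add_def, add_add_add_comm]
    · simp only [dotProduct, Pi.add_apply, Int.cast_add, mul_add, Finset.sum_add_distrib,
        Nat.cast_add]
      ring

end Penalized

/-! ### Scalar strong duality -/

/-- Every upper bound `r` of the integer program bounds the value of some dual feasible
function. -/
theorem exists_isDualFeasible_le {m n : ℕ} {A : Matrix (Fin m) (Fin n) ℝ}
    (hA : ∀ i j, ∃ q : ℚ, A i j = (q : ℝ)) {b : Fin m → ℝ} {c : Fin n → ℝ}
    (hc : ∀ d ∈ moipFeasible A 0, c ⬝ᵥ (fun j => (d j : ℝ)) ≤ 0) {r : ℝ}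
    (hr : ∀ x ∈ moipFeasible A b, c ⬝ᵥ (fun j => (x j : ℝ)) ≤ r) :
    ∃ f, IsDualFeasible A c f ∧ f b ≤ r := by
  obtain ⟨y, hy, hyc⟩ := exists_dual_multipliers hA hc
  -- The first bound on M gives dual feasibility; the second brings the LP bound at b down to r
  -- already for t = 1.
  have hM₁ := le_max_left (∑ i, y i) (y ⬝ᵥ b + ∑ i, y i - r)
  have hM₂ := le_max_right (∑ i, y i) (y ⬝ᵥ b + ∑ i, y i - r)
  set M := max (∑ i, y i) (y ⬝ᵥ b + ∑ i, y i - r)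
  refine ⟨_, isDualFeasible_sSup_penalizedValues hy hyc hM₁,
    csSup_le (penalizedValues_nonempty _ _ _ _) ?_⟩
  rintro _ ⟨t, x, hx, rfl⟩
  rcases Nat.eq_zero_or_pos t with rfl | ht
  · simpa using hr x (by simpa [← Pi.zero_def] using hx)
  · have h₁ := le_of_mem_penalized hy hyc hx
    have h₂ : (1 : ℝ) ≤ t := by exact_mod_cast ht
    have h₃ := mul_nonneg (sub_nonneg.2 hM₁) (sub_nonneg.2 h₂)
    linarith

/-- Strong duality: the superadditive dual has an optimal solution exactly when the integer
program has one, and the optimal values agree. -/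
theorem isLeast_dual_iff_isGreatest {m n : ℕ} {A : Matrix (Fin m) (Fin n) ℝ}
    (hA : ∀ i j, ∃ q : ℚ, A i j = (q : ℝ)) {b : Fin m → ℝ} {c : Fin n → ℝ} {p : ℝ} :
    IsLeast {r | ∃ f, IsDualFeasible A c f ∧ r = f b} p ↔
      IsGreatest {r : ℝ | ∃ x ∈ moipFeasible A b, r = c ⬝ᵥ (fun j => (x j : ℝ))} p := by
  constructor
  · rintro ⟨⟨f, hf, rfl⟩, hmin⟩
    have hc := hf.dotProduct_recession_nonpos
    have hle : ∀ r, (∀ x ∈ moipFeasible A b, c ⬝ᵥ (fun j => (x j : ℝ)) ≤ r) → f b ≤ r := by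
      intro r hr
      obtain ⟨g, hg, hgr⟩ := exists_isDualFeasible_le hA hc hr
      exact (hmin ⟨g, hg, rfl⟩).trans hgr
    -- For an infeasible program every real is an upper bound, so the dual would have no minimum.
    have hne : (moipFeasible A b).Nonempty := by
      by_contra hempty
      have := hle (f b - 1) fun x hx => (hempty ⟨x, hx⟩).elim
      linarith
    obtain ⟨r, hr⟩ := exists_isGreatest_dotProduct hA hc hne
    have hrf : r = f b := by
      obtain ⟨x, hx, hrx⟩ := hr.1
      exact le_antisymm (hrx ▸ hf.dotProduct_le hx) (hle r fun x hx => hr.2 ⟨x, hx, rfl⟩)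
    exact hrf ▸ hr
  · rintro ⟨⟨x, hx, rfl⟩, hmax⟩
    have hc : ∀ d ∈ moipFeasible A 0, c ⬝ᵥ (fun j => (d j : ℝ)) ≤ 0 := by
      intro d hd
      have h := hmax ⟨x + d, add_recession_mem_moipFeasible hx hd, rfl⟩
      simp only [dotProduct, Pi.add_apply, Int.cast_add, mul_add, Finset.sum_add_distrib] at h ⊢
      linarith
    obtain ⟨f, hf, hfb⟩ := exists_isDualFeasible_le hA hc (fun w hw => hmax ⟨w, hw, rfl⟩)
    refine ⟨⟨f, hf, le_antisymm (hf.dotProduct_le hx) hfb⟩, ?_⟩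
    rintro _ ⟨g, hg, rfl⟩
    exact hg.dotProduct_le hx

/-! ### The vector-valued dual -/

/-- A nondominated point of the vector-valued dual minimizes each component separately. -/
theorem mem_vsdpNondominated_iff {m n k : ℕ} {A : Matrix (Fin m) (Fin n) ℝ} {b : Fin m → ℝ}
    {C : Matrix (Fin k) (Fin n) ℝ} {p : Fin k → ℝ} :
    p ∈ vsdpNondominated A b C ↔
      ∀ i, IsLeast {r | ∃ f, IsDualFeasible A (C i) f ∧ r = f b} (p i) := by
  classical
  constructor
  · rintro ⟨⟨F, hF, rfl⟩, hmin⟩ i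
    rw [vsdpFeasible_iff] at hF
    refine ⟨⟨F i, hF i, rfl⟩, ?_⟩
    rintro _ ⟨f, hf, rfl⟩
    by_contra! hlt
    -- Improving a single component would dominate F.
    refine hmin ⟨_, ⟨Function.update F i f, vsdpFeasible_iff.2 fun l => ?_, rfl⟩, fun l => ?_,
      fun h => ?_⟩
    · by_cases hl : l = i
      · subst hl; simpa using hf
      · simpa [hl] using hF l
    · by_cases hl : l = i
      · subst hl; simpa using hlt.le
      · simp [hl]
    · have := congrFun h i
      simp only [Function.update_self] at this
      exact hlt.ne this
  · intro h
    choose F hF hp using fun i => (h i).1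
    refine ⟨⟨F, vsdpFeasible_iff.2 hF, funext hp⟩, ?_⟩
    rintro ⟨_, ⟨G, hG, rfl⟩, hle, hne⟩
    exact hne (le_antisymm hle fun i => (h i).2 ⟨G i, vsdpFeasible_iff.1 hG i, rfl⟩)

theorem vsdpNondominated_subsingleton {m n k : ℕ} (A : Matrix (Fin m) (Fin n) ℝ)
    (b : Fin m → ℝ) (C : Matrix (Fin k) (Fin n) ℝ) : (vsdpNondominated A b C).Subsingleton :=
  fun _ hp _ hq => funext fun i =>
    (mem_vsdpNondominated_iff.1 hp i).unique (mem_vsdpNondominated_iff.1 hq i)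

theorem mem_vsdpNondominated_iff_isIdealPoint {m n k : ℕ} {A : Matrix (Fin m) (Fin n) ℝ}
    (hA : ∀ i j, ∃ q : ℚ, A i j = (q : ℝ)) {b : Fin m → ℝ} {C : Matrix (Fin k) (Fin n) ℝ}
    {p : Fin k → ℝ} : p ∈ vsdpNondominated A b C ↔ IsIdealPoint A b C p :=
  mem_vsdpNondominated_iff.trans (forall_congr' fun _ => isLeast_dual_iff_isGreatest hA)

/-- A feasible value that bounds all feasible values is the unique nondominated point and the
ideal point. -/
theorem moipNondominated_eq_singleton {m n k : ℕ} {A : Matrix (Fin m) (Fin n) ℝ}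
    {b : Fin m → ℝ} {C : Matrix (Fin k) (Fin n) ℝ} {z : Fin k → ℝ}
    (hz : IsGreatest (moipValues A b C) z) :
    moipNondominated A b C = {z} ∧ IsIdealPoint A b C z := by
  constructor
  · ext p
    refine ⟨fun hp => ?_, ?_⟩
    · by_contra hne
      exact hp.2 ⟨z, hz.1, hz.2 hp.1, hne⟩
    · rintro rfl
      exact ⟨hz.1, fun ⟨t, ht, hle, hne⟩ => hne (le_antisymm hle (hz.2 ht))⟩
  · intro i
    obtain ⟨x, hx, hzx⟩ := hz.1
    refine ⟨⟨x, hx, congrFun hzx i⟩, ?_⟩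
    rintro _ ⟨w, hw, rfl⟩
    exact hz.2 ⟨w, hw, rfl⟩ i

/-- For a rational constraint matrix, a unique nondominated point dominates all feasible
values. -/
theorem isGreatest_of_moipNondominated_eq_singleton {m n k : ℕ} {A : Matrix (Fin m) (Fin n) ℝ}
    (hA : ∀ i j, ∃ q : ℚ, A i j = (q : ℝ)) {b : Fin m → ℝ} {C : Matrix (Fin k) (Fin n) ℝ}
    {z : Fin k → ℝ} (hz : moipNondominated A b C = {z}) : IsGreatest (moipValues A b C) z := by
  have hmem : z ∈ moipNondominated A b C := hz ▸ rfl
  obtain ⟨⟨x, hx, hzx⟩, hmax⟩ := hmem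
  refine ⟨⟨x, hx, hzx⟩, ?_⟩
  rintro _ ⟨w, hw, rfl⟩
  -- An improving recession direction d would let x + d dominate z.
  obtain ⟨z', hz', hle⟩ := exists_moipNondominated_ge (C := C) hA (fun d hd hpos => by
    have hlt : z < C *ᵥ (fun j => ((x + d) j : ℝ)) := by
      rw [mulVec_intCast_add, hzx]
      exact lt_add_of_pos_right _ hpos
    exact hmax ⟨_, ⟨x + d, add_recession_mem_moipFeasible hx hd, rfl⟩, hlt.le, hlt.ne⟩) hw
  rw [hz] at hz'
  exact hz' ▸ hle

theorem mainTheorem3 {m n k : ℕ} (A : Matrix (Fin m) (Fin n) ℝ) (b : Fin m → ℝ)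
    (C : Matrix (Fin k) (Fin n) ℝ) :
    (VSDPStrong A b C →
      ∃ z, moipNondominated A b C = {z} ∧ vsdpNondominated A b C = {z} ∧
        IsIdealPoint A b C z) ∧
    (vsdpNondominated A b C).Subsingleton ∧
    ((∀ i j, ∃ q : ℚ, A i j = (q : ℝ)) →
      (VSDPStrong A b C ↔ ∃! z, z ∈ moipNondominated A b C) ∧
      (∀ z, moipNondominated A b C = {z} → vsdpNondominated A b C = {z}) ∧
      (∀ p, p ∈ vsdpNondominated A b C ↔ IsIdealPoint A b C p)) := by
  have hsub := vsdpNondominated_subsingleton A b C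
  have hstrong : VSDPStrong A b C →
      ∃ z, moipNondominated A b C = {z} ∧ vsdpNondominated A b C = {z} ∧
        IsIdealPoint A b C z := by
    rintro ⟨F, hF, hvsdp, hmoip⟩
    have hz : IsGreatest (moipValues A b C) (fun i => F i b) := by
      refine ⟨hmoip.1, ?_⟩
      rintro _ ⟨x, hx, rfl⟩ i
      exact (vsdpFeasible_iff.1 hF i).dotProduct_le hx
    obtain ⟨hsing, hideal⟩ := moipNondominated_eq_singleton hz
    exact ⟨_, hsing, hsub.eq_singleton_of_mem hvsdp, hideal⟩
  refine ⟨hstrong, hsub, fun hA => ?_⟩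
  have hsing : ∀ z, moipNondominated A b C = {z} → z ∈ vsdpNondominated A b C := fun z hz =>
    (mem_vsdpNondominated_iff_isIdealPoint hA).2
      (moipNondominated_eq_singleton (isGreatest_of_moipNondominated_eq_singleton hA hz)).2
  refine ⟨⟨fun h => ?_, ?_⟩, fun z hz => hsub.eq_singleton_of_mem (hsing z hz),
    fun p => mem_vsdpNondominated_iff_isIdealPoint hA⟩
  · obtain ⟨z, hz, -⟩ := hstrong h
    exact ⟨z, hz ▸ rfl, fun p hp => by rwa [hz] at hp⟩
  · rintro ⟨z, hz, huniq⟩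
    have hvsdp := hsing z (Set.eq_singleton_iff_unique_mem.2 ⟨hz, huniq⟩)
    obtain ⟨F, hF, rfl⟩ := hvsdp.1
    exact ⟨F, hF, hvsdp, hz⟩
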